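/- Let $X$ and $Z$ be real Hausdorff locally convex topological vector spaces with $Z\neq\{0\}$, and let $L(X,Z)$ be the set of continuous linear maps $X\to Z$; write $\langle T,x\rangle=T(x)$. Let $C\subseteq Z$ be a convex cone (so $0\in C$, $C+C\subseteq C$ and $tC\subseteq C$ for all $t\ge 0$) that is pointed, i.e. $C\cap(-C)=\{0\}$, and has nonempty interior. Let $K\subseteq X$ be nonempty, convex and compact, and let $D\subseteq K$ be self-segment-dense in $K$, i.e. $D$ is dense in $K$ and, for all $x,y\in D$, the set $[x,y]\cap D$ is dense in the segment $[x,y]$. Let $F:K\to L(X,Z)$ satisfy: (i) for every $x\in K$, the map $g:K\to Z$, $g(y)=\langle F(y),y-x\rangle$, is $C$-upper semicontinuous at every point $y$ of $K\setminus D$, i.e. for every neighbourhood $V$ of $g(y)$ there is a neighbourhood $U$ of $y$ such that $g(u)\in V-C$ for all $u\in U\cap K$; (ii) for every $x\in D$, the map $g(y)=\langle F(y),y-x\rangle$ is $C$-convex on $D$, i.e. for all $n\in\mathbb N$, $y_1,\dots,y_n\in D$ and $\lambda_1,\dots,\lambda_n\ge 0$ with $\sum_{i=1}^n\lambda_i=1$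 and $\sum_{i=1}^n\lambda_i y_i\in D$, one has $\sum_{i=1}^n\lambda_i\, g(y_i)-g\left(\sum_{i=1}^n\lambda_i y_i\right)\in C$. Then there exists $x_0\in K$ such that $$\langle F(y),y-x_0\rangle\notin-\operatorname{int}C\qquad\text{for all } y\in K.$$ -/

import Mathlib

open scoped Topology Pointwise

/-- A set `U ⊆ V` is self-segment-dense in the (convex) set `V` if it is dense in `V` and, for all
`x, y ∈ U`, the set `[x, y] ∩ U` is dense in the closed segment `[x, y]`. -/
structure IsSelfSegmentDense {X : Type*} [AddCommGroup X] [Module ℝ X] [TopologicalSpace X]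
    (U V : Set X) : Prop where
  subset : U ⊆ V
  dense : V ⊆ closure U
  segment_dense : ∀ x ∈ U, ∀ y ∈ U, segment ℝ x y ⊆ closure (segment ℝ x y ∩ U)

/-- The map `f : K → Z` is `C`-upper semicontinuous at the point `x` of `K`: for every
neighbourhood `V` of `f x` there is a neighbourhood `W` of `x` with `f u ∈ V - C` for all
`u ∈ W ∩ K`. Only the values of `f` on `K` (and at `x`) are used. -/
def ConeUpperSemicontinuousAt {X Z : Type*} [TopologicalSpace X]
    [AddCommGroup Z] [TopologicalSpace Z]
    (C : Set Z) (K : Set X) (f : X → Z) (x : X) : Prop :=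
  ∀ V ∈ 𝓝 (f x), ∃ W ∈ 𝓝 x, ∀ u ∈ W ∩ K, f u ∈ V - C

/-- The map `f` is `C`-convex on the (not necessarily convex) set `D`: for every convex combination
of points of `D` which itself belongs to `D`, one has `f (∑ lᵢ xᵢ) ≤ ∑ lᵢ f xᵢ` in the order
induced by the cone `C`, in which `z₁ ≤ z₂` means `z₂ - z₁ ∈ C`. -/
def ConeConvexOn {X Z : Type*} [AddCommGroup X] [Module ℝ X] [AddCommGroup Z] [Module ℝ Z]
    (C : Set Z) (D : Set X) (f : X → Z) : Prop :=
  ∀ (n : ℕ) (x : Fin n → X) (l : Fin n → ℝ),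
    (∀ i, x i ∈ D) → (∀ i, 0 ≤ l i) → ∑ i, l i = 1 → ∑ i, l i • x i ∈ D →
      (∑ i, l i • f (x i)) - f (∑ i, l i • x i) ∈ C

/-! Scalarize by a functional `φ` nonnegative on `C` and positive on its interior: it is enough that
`φ (F y (y - x₀)) ≥ 0` for `y ∈ D`, since upper semicontinuity and density then handle `K \ D`.
These conditions are closed in `x₀`, so compactness reduces to finitely many `y i`. For these, seek
`x₀ = ∑ l j • y j` and put `A i j = φ (F (y i) (y i - y j))`. Convexity gives `lᵀ A l ≥ 0` when `∑ l
j • y j ∈ D`; such weights are dense in the simplex, so this holds on all of it, and a separation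
argument yields `l` with `A l ≥ 0`. -/

/-- The continuous affine combination map along a segment reflects density of a set. -/
theorem mem_closure_lineMap_preimage {X : Type*} [AddCommGroup X] [Module ℝ X]
    [TopologicalSpace X] [IsTopologicalAddGroup X] [ContinuousSMul ℝ X] [T2Space X]
    {D : Set X} {p q : X} (hp : p ∈ D)
    (h : segment ℝ p q ⊆ closure (segment ℝ p q ∩ D)) {t : ℝ} (ht : t ∈ Set.Icc (0 : ℝ) 1) :
    t ∈ closure {s : ℝ | s ∈ Set.Icc (0 : ℝ) 1 ∧ (1 - s) • p + s • q ∈ D} := by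
  by_cases hpq : p = q
  · subst hpq
    refine subset_closure ⟨ht, ?_⟩
    rwa [← add_smul, sub_add_cancel, one_smul]
  let g : Set.Icc (0 : ℝ) 1 → X := fun s => (1 - (s : ℝ)) • p + (s : ℝ) • q
  have hg : Continuous g := by fun_prop
  have hginj : Function.Injective g := by
    intro a b hab
    have h0 : ((b : ℝ) - a) • (p - q) = 0 := by
      have : g a - g b = 0 := sub_eq_zero.2 hab
      rw [← this]
      simp only [g]
      module
    rcases smul_eq_zero.1 h0 with h1 | h1
    · exact Subtype.ext (by linarith)
    · exact absurd (sub_eq_zero.1 h1) hpq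
  -- Compactness of `[0, 1]` and the Hausdorff property let closures be pulled back along `g`.
  have hge : Topology.IsClosedEmbedding g := hg.isClosedEmbedding hginj
  have himg : segment ℝ p q ∩ D ⊆ g '' (g ⁻¹' D) := by
    rintro z ⟨hz, hzD⟩
    rw [segment_eq_image] at hz
    obtain ⟨s, hs, rfl⟩ := hz
    exact ⟨⟨s, hs⟩, hzD, rfl⟩
  have hmem : g ⟨t, ht⟩ ∈ g '' closure (g ⁻¹' D) := by
    rw [← hge.closure_image_eq]
    refine closure_mono himg (h ?_)
    rw [segment_eq_image]
    exact ⟨t, ht, rfl⟩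
  have ht' : (⟨t, ht⟩ : Set.Icc (0 : ℝ) 1) ∈ closure (g ⁻¹' D) := by
    obtain ⟨s, hs, hst⟩ := hmem
    rwa [← hginj hst]
  exact map_mem_closure continuous_subtype_val ht' fun s hs => ⟨s.2, hs⟩

/-- If `D` is self-segment-dense, then the weights of the convex combinations of points of `D`
which belong to `D` are dense in the standard simplex. -/
theorem IsSelfSegmentDense.stdSimplex_subset_closure {X : Type*} [AddCommGroup X] [Module ℝ X]
    [TopologicalSpace X] [IsTopologicalAddGroup X] [ContinuousSMul ℝ X] [T2Space X]
    {D K : Set X} (hD : IsSelfSegmentDense D K) {ι : Type*} [Fintype ι] (y : ι → X)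
    (hy : ∀ i, y i ∈ D) :
    stdSimplex ℝ ι ⊆ closure {l | l ∈ stdSimplex ℝ ι ∧ ∑ i, l i • y i ∈ D} := by
  classical
  set S : Set (ι → ℝ) := {l | l ∈ stdSimplex ℝ ι ∧ ∑ i, l i • y i ∈ D}
  have hseg : ∀ t ∈ Set.Icc (0 : ℝ) 1, ∀ a ∈ S, ∀ b ∈ S, (1 - t) • a + t • b ∈ closure S := by
    intro t ht a ha b hb
    have hc := mem_closure_lineMap_preimage ha.2 (hD.segment_dense _ ha.2 _ hb.2) ht
    refine map_mem_closure (f := fun s : ℝ => (1 - s) • a + s • b) (by fun_prop) hc ?_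
    rintro s ⟨hs, hsD⟩
    refine ⟨convex_stdSimplex ℝ ι ha.1 hb.1 (sub_nonneg.2 hs.2) hs.1 (sub_add_cancel _ _), ?_⟩
    convert hsD using 1
    simp only [Pi.add_apply, Pi.smul_apply, smul_eq_mul, add_smul, mul_smul,
      Finset.sum_add_distrib, Finset.smul_sum]
  -- `hseg` treats endpoints in `S` only; continuity extends it to the closure. The simplex is then
  -- the hull of its vertices, which lie in `S`.
  have hconv : Convex ℝ (closure S) := by
    intro a ha b hb u v hu hv huv
    obtain rfl : u = 1 - v := by linarith
    have := map_mem_closure₂ (f := fun a b : ι → ℝ => (1 - v) • a + v • b) (u := closure S)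
      (by fun_prop) ha hb
      (fun a ha b hb => hseg v ⟨hv, by linarith⟩ a ha b hb)
    rwa [closure_closure] at this
  rw [← convexHull_basis_eq_stdSimplex]
  refine convexHull_min ?_ hconv
  rintro _ ⟨i, rfl⟩
  refine subset_closure ⟨?_, ?_⟩
  · simpa using ite_eq_mem_stdSimplex ℝ i
  · simpa [ite_smul] using hy i

/-- A matrix whose quadratic form is nonnegative on the standard simplex maps some point of the
simplex into the nonnegative orthant. -/
theorem exists_mem_stdSimplex_mulVec_nonneg {ι : Type*} [Fintype ι] [Nonempty ι]
    (A : Matrix ι ι ℝ) (hA : ∀ l ∈ stdSimplex ℝ ι, 0 ≤ ∑ i, l i * A.mulVec l i) :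
    ∃ l ∈ stdSimplex ℝ ι, ∀ i, 0 ≤ A.mulVec l i := by
  classical
  by_contra! hcon
  have hlin : Continuous A.mulVecLin := LinearMap.continuous_of_finiteDimensional _
  have hcompact : IsCompact (A.mulVecLin '' stdSimplex ℝ ι) :=
    (isCompact_stdSimplex ℝ ι).image hlin
  have hdisj : Disjoint (A.mulVecLin '' stdSimplex ℝ ι) (Set.Ici 0) := by
    rw [Set.disjoint_left]
    rintro _ ⟨l, hl, rfl⟩ hl0
    obtain ⟨i, hi⟩ := hcon l hl
    exact hi.not_ge (hl0 i)
  obtain ⟨f, u, v, hfu, huv, hfv⟩ := geometric_hahn_banach_compact_closed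
    ((convex_stdSimplex ℝ ι).linear_image A.mulVecLin) hcompact (convex_Ici 0) isClosed_Ici hdisj
  have hv : v < 0 := by simpa using hfv 0 (Set.mem_Ici.2 le_rfl)
  set m : ι → ℝ := fun i => f (Pi.single i 1)
  have hf : ∀ z, f z = ∑ i, m i * z i := by
    intro z
    conv_lhs => rw [pi_eq_sum_univ' z]
    simp only [map_sum, map_smul, smul_eq_mul, m]
    refine Finset.sum_congr rfl fun i _ => ?_
    rw [mul_comm]
  have hm : ∀ i, 0 ≤ m i := by
    intro i
    by_contra! hi
    -- This point of the orthant is scaled so that `f` equals `v` there, against the strict bound.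
    have h1 := hfv ((v / m i) • Pi.single i 1) (by
      rw [Set.mem_Ici]
      exact smul_nonneg (div_nonneg_of_nonpos hv.le hi.le)
        (Pi.single_nonneg.2 zero_le_one))
    rw [map_smul, smul_eq_mul] at h1
    change v < v / m i * m i at h1
    rw [div_mul_cancel₀ _ hi.ne] at h1
    exact lt_irrefl _ h1
  have hneg : ∀ l ∈ stdSimplex ℝ ι, ∑ i, m i * A.mulVec l i < 0 := by
    intro l hl
    have := hfu _ ⟨l, hl, rfl⟩
    rw [hf] at this
    exact this.trans (huv.trans hv)
  have hs0 : 0 ≤ ∑ i, m i := Finset.sum_nonneg fun i _ => hm i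
  have hs : 0 < ∑ i, m i := by
    refine hs0.lt_of_ne fun h0 => ?_
    have hz := (Finset.sum_eq_zero_iff_of_nonneg fun i _ => hm i).1 h0.symm
    have := hneg _ (ite_eq_mem_stdSimplex ℝ (Classical.arbitrary ι))
    rw [Finset.sum_eq_zero fun i hi => by rw [hz i hi, zero_mul]] at this
    exact lt_irrefl _ this
  have hl : (∑ i, m i)⁻¹ • m ∈ stdSimplex ℝ ι := by
    refine ⟨fun i => mul_nonneg (inv_nonneg.2 hs0) (hm i), ?_⟩
    simp only [Pi.smul_apply, smul_eq_mul, ← Finset.mul_sum]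
    exact inv_mul_cancel₀ hs.ne'
  -- The normalized separating functional is itself a simplex point at which the quadratic form is
  -- negative.
  have h1 := hA _ hl
  have h2 := hneg _ hl
  simp only [Pi.smul_apply, smul_eq_mul, mul_assoc, ← Finset.mul_sum] at h1
  exact h2.not_ge (nonneg_of_mul_nonneg_right h1 (inv_pos.2 hs))

section Cone

variable {Z : Type*} [AddCommGroup Z] [Module ℝ Z] [TopologicalSpace Z]

theorem PointedCone.add_mem_interior [IsTopologicalAddGroup Z] (C : PointedCone ℝ Z) {a c : Z}
    (ha : a ∈ interior (C : Set Z)) (hc : c ∈ C) : a + c ∈ interior (C : Set Z) := by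
  have hsub : interior (C : Set Z) + {c} ⊆ interior (C : Set Z) := by
    refine interior_maximal ?_ isOpen_interior.add_right
    rintro _ ⟨x, hx, _, rfl, rfl⟩
    exact C.add_mem (interior_subset hx) hc
  exact hsub ⟨a, ha, c, rfl, rfl⟩

variable [ContinuousSMul ℝ Z]

/-- A cone that is a neighbourhood of `0` absorbs every vector, so it is all of `Z`. -/
theorem PointedCone.zero_notMem_interior [Nontrivial Z] (C : PointedCone ℝ Z)
    (hC : (C : Set Z) ∩ -(C : Set Z) = {0}) : (0 : Z) ∉ interior (C : Set Z) := by
  intro h0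
  have hmem : ∀ z : Z, z ∈ C := by
    intro z
    have htend : Filter.Tendsto (fun t : ℝ => t • z) (𝓝[>] 0) (𝓝 0) := by
      have : Filter.Tendsto (fun t : ℝ => t • z) (𝓝 0) (𝓝 ((0 : ℝ) • z)) :=
        (continuous_id.smul continuous_const).tendsto 0
      rw [zero_smul] at this
      exact this.mono_left nhdsWithin_le_nhds
    obtain ⟨t, htC, ht⟩ := ((htend.eventually (mem_interior_iff_mem_nhds.1 h0)).and
      self_mem_nhdsWithin).exists
    have ht : 0 < t := ht
    have := C.smul_mem (inv_nonneg.2 ht.le) htC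
    rwa [inv_smul_smul₀ ht.ne'] at this
  obtain ⟨z, hz⟩ := exists_ne (0 : Z)
  have : z ∈ (C : Set Z) ∩ -(C : Set Z) := ⟨hmem z, hmem (-z)⟩
  rw [hC] at this
  exact hz this

/-- A proper cone with nonempty interior has a nonzero continuous positive functional, which is
strictly positive on the interior. -/
theorem PointedCone.exists_pos_on_interior [IsTopologicalAddGroup Z] (C : PointedCone ℝ Z)
    (h0 : (0 : Z) ∉ interior (C : Set Z)) (hC : (interior (C : Set Z)).Nonempty) :
    ∃ φ : Z →L[ℝ] ℝ, (∀ z ∈ C, 0 ≤ φ z) ∧ ∀ z ∈ interior (C : Set Z), 0 < φ z := by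
  obtain ⟨f, hf⟩ := geometric_hahn_banach_point_open C.convex.interior isOpen_interior h0
  simp only [map_zero] at hf
  refine ⟨f, fun z hz => ?_, hf⟩
  obtain ⟨e, he⟩ := hC
  by_contra! hneg
  -- With this factor `t`, `f` vanishes at the interior point `e + t • z`.
  have ht : 0 ≤ f e / -f z := div_nonneg (hf e he).le (neg_nonneg.2 hneg.le)
  have := hf _ (C.add_mem_interior he (C.smul_mem ht hz))
  rw [map_add, map_smul, smul_eq_mul, div_neg, neg_mul, div_mul_cancel₀ _ hneg.ne,
    add_neg_cancel] at this
  exact lt_irrefl _ this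

end Cone

/-- Scalarized finite solvability: finitely many inequalities given by points of a
self-segment-dense set have a common solution. -/
theorem IsSelfSegmentDense.exists_forall_nonneg {X : Type*} [AddCommGroup X] [Module ℝ X]
    [TopologicalSpace X] [IsTopologicalAddGroup X] [ContinuousSMul ℝ X] [T2Space X]
    {D K : Set X} (hD : IsSelfSegmentDense D K) (hK : Convex ℝ K) {ι : Type*} [Fintype ι]
    [Nonempty ι] (y : ι → X) (hy : ∀ i, y i ∈ D) (T : ι → X →L[ℝ] ℝ)
    (hT : ∀ l ∈ stdSimplex ℝ ι, ∑ i, l i • y i ∈ D →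
      0 ≤ ∑ i, l i * T i (y i - ∑ j, l j • y j)) :
    ∃ x ∈ K, ∀ i, 0 ≤ T i (y i - x) := by
  set A : Matrix ι ι ℝ := fun i j => T i (y i - y j)
  have hAl : ∀ l ∈ stdSimplex ℝ ι, ∀ i, A.mulVec l i = T i (y i - ∑ j, l j • y j) := by
    intro l hl i
    have : y i - ∑ j, l j • y j = ∑ j, l j • (y i - y j) := by
      simp only [smul_sub, Finset.sum_sub_distrib, ← Finset.sum_smul, hl.2, one_smul]
    rw [this, map_sum]
    simp only [Matrix.mulVec, dotProduct, map_smul, smul_eq_mul, A]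
    exact Finset.sum_congr rfl fun j _ => mul_comm _ _
  have hclosed : IsClosed {l : ι → ℝ | 0 ≤ ∑ i, l i * T i (y i - ∑ j, l j • y j)} :=
    isClosed_le continuous_const (by fun_prop)
  obtain ⟨l, hl, hl0⟩ := exists_mem_stdSimplex_mulVec_nonneg A (fun l hl => by
    have hmem := hclosed.closure_subset_iff.2 (fun l hl => hT l hl.1 hl.2)
      (hD.stdSimplex_subset_closure y hy hl)
    simp only [hAl l hl]
    exact hmem)
  exact ⟨∑ j, l j • y j, hK.sum_mem (fun i _ => hl.1 i) hl.2 fun i _ => hD.subset (hy i),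
    fun i => hAl l hl i ▸ hl0 i⟩

theorem mainTheorem11
    {X Z : Type*}
    [AddCommGroup X] [Module ℝ X] [TopologicalSpace X] [IsTopologicalAddGroup X]
    [ContinuousSMul ℝ X] [LocallyConvexSpace ℝ X] [T2Space X]
    [AddCommGroup Z] [Module ℝ Z] [TopologicalSpace Z] [IsTopologicalAddGroup Z]
    [ContinuousSMul ℝ Z] [LocallyConvexSpace ℝ Z] [T2Space Z] [Nontrivial Z]
    (C : PointedCone ℝ Z)
    (hC_pointed : (C : Set Z) ∩ -(C : Set Z) = {0})
    (hC_int : (interior (C : Set Z)).Nonempty)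
    (K : Set X) (hK_ne : K.Nonempty) (hK_convex : Convex ℝ K) (hK_compact : IsCompact K)
    (D : Set X) (hD : IsSelfSegmentDense D K)
    (F : X → (X →L[ℝ] Z))
    (h_usc : ∀ x ∈ K, ∀ y ∈ K \ D,
      ConeUpperSemicontinuousAt (C : Set Z) K (fun y => F y (y - x)) y)
    (h_convex : ∀ x ∈ D, ConeConvexOn (C : Set Z) D (fun y => F y (y - x))) :
    ∃ x₀ ∈ K, ∀ y ∈ K, F y (y - x₀) ∉ -interior (C : Set Z) := by
  obtain ⟨φ, hφC, hφint⟩ := C.exists_pos_on_interior (C.zero_notMem_interior hC_pointed) hC_int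
  have hφneg : ∀ z, 0 ≤ φ z → z ∉ -interior (C : Set Z) := by
    intro z hz hzC
    have := hφint _ hzC
    rw [map_neg] at this
    linarith
  have hfin : ∀ (n : ℕ) (y : Fin n → X), (∀ i, y i ∈ D) →
      ∃ x ∈ K, ∀ i, 0 ≤ φ (F (y i) (y i - x)) := by
    intro n y hy
    rcases n.eq_zero_or_pos with rfl | hn
    · exact hK_ne.imp fun x hx => ⟨hx, fun i => i.elim0⟩
    have : Nonempty (Fin n) := ⟨⟨0, hn⟩⟩
    refine hD.exists_forall_nonneg hK_convex y hy (fun i => φ.comp (F (y i))) fun l hl hlD => ?_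
    -- The base point is the combination itself, so the subtracted value is `0`.
    have := hφC _ (h_convex _ hlD n y l hy hl.1 hl.2 hlD)
    simpa using this
  have hclosed : ∀ y : D, IsClosed {x | 0 ≤ φ (F y (y - x))} := fun y =>
    isClosed_le continuous_const (by fun_prop)
  obtain ⟨x₀, hx₀K, hx₀⟩ := hK_compact.inter_iInter_nonempty _ hclosed fun t => by
    obtain ⟨x, hxK, hx⟩ := hfin t.card (fun i => ((t.equivFin.symm i : D) : X))
      fun i => (t.equivFin.symm i : D).2
    refine ⟨x, hxK, Set.mem_iInter₂.2 fun y hy => ?_⟩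
    simpa using hx (t.equivFin ⟨y, hy⟩)
  rw [Set.mem_iInter] at hx₀
  have hsolD : ∀ y ∈ D, F y (y - x₀) ∉ -interior (C : Set Z) := fun y hy =>
    hφneg _ (hx₀ ⟨y, hy⟩)
  refine ⟨x₀, hx₀K, fun y hy hyC => ?_⟩
  by_cases hyD : y ∈ D
  · exact hsolD y hyD hyC
  -- Since `-int C - C ⊆ -int C`, a violation at `y` spreads to nearby points of `D`.
  obtain ⟨W, hW, hWK⟩ := h_usc x₀ hx₀K y ⟨hy, hyD⟩ _ (isOpen_interior.neg.mem_nhds hyC)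
  obtain ⟨u, huW, huD⟩ := mem_closure_iff_nhds.1 (hD.dense hy) W hW
  obtain ⟨a, ha, c, hc, hac⟩ := hWK u ⟨huW, hD.subset huD⟩
  refine hsolD u huD ?_
  rw [Set.mem_neg]
  have := C.add_mem_interior ha hc
  have hac : a - c = F u (u - x₀) := hac
  rwa [neg_add_eq_sub, ← neg_sub, hac] at this
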